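/- Let $K$ be a field of characteristic zero and let $S=K[X_0,\dots,X_n]$ with its standard grading. For a finite set $\mathbb{X}$ of $K$-rational points of $\mathbb{P}^n$ let $I_{\mathbb{X}}=\bigcap_{P\in\mathbb{X}} I_P\subseteq S$ be its homogeneous vanishing ideal, where $I_P$ is the ideal generated by all homogeneous polynomials vanishing at $P$. For a homogeneous ideal $I\subseteq S$ let $I_i=I\cap S_i$ be its homogeneous component of degree $i$, and let $\partial I=\langle \partial F/\partial X_j \mid F\in I,\ 0\le j\le n\rangle$. Let $\mathbb{X}$ be a set of $s\ge 2$ distinct $K$-rational points in $\mathbb{P}^n$, let $\mathbb{Y}$ be a non-empty subset of $\mathbb{X}$, and let $k,\ell\ge 0$. Then there is $i_0\in\mathbb{N}$ such that for all $i\ge i_0$ $$(I_{\mathbb{X}}^k\cdot I_{\mathbb{Y}}^\ell)_i\subseteq\bigl(\partial(I_{\mathbb{X}}^{k+1}\cdot I_{\mathbb{Y}}^\ell)\bigr)_i.$$ Furthermore, let $K=\mathbb{Q}$, $n=2$, and consider the sets $\mathbb{X}=\{(1:0:0),(1:0:1),(1:1:0),(1:1:1)\}$ and $\mathbb{Y}=\{(1:0:0),(1:0:1),(1:2:0),(1:2:1)\}$,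 where $\mathbb{Y}\not\subseteq\mathbb{X}$. Then $(I_{\mathbb{X}}\cdot I_{\mathbb{Y}})_4\not\subseteq(\partial(I_{\mathbb{X}}^2\cdot I_{\mathbb{Y}}))_4$; in particular $I_{\mathbb{X}}\cdot I_{\mathbb{Y}}\not\subseteq\partial(I_{\mathbb{X}}^2\cdot I_{\mathbb{Y}})$. -/

import Mathlib

open scoped LinearAlgebra.Projectivization

noncomputable section

namespace FatPoints

open MvPolynomial

/-- The homogeneous prime ideal of a `K`-rational point `P` of projective `n`-space: the ideal of
`K[X_0, …, X_n]` generated by the homogeneous polynomials vanishing at `P`. For a homogeneous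
polynomial the condition does not depend on the chosen representative of `P`. -/
def pointIdeal {K : Type*} [Field K] {n : ℕ} (P : ℙ K (Fin (n + 1) → K)) :
    Ideal (MvPolynomial (Fin (n + 1)) K) :=
  Ideal.span {F | (∃ d : ℕ, F.IsHomogeneous d) ∧ eval P.rep F = 0}

/-- The homogeneous vanishing ideal `I_X = ⋂_{P ∈ X} I_P` of a set of points `X`. -/
def vanishingIdeal {K : Type*} [Field K] {n : ℕ} (X : Set (ℙ K (Fin (n + 1) → K))) :
    Ideal (MvPolynomial (Fin (n + 1)) K) :=
  ⨅ P ∈ X, pointIdeal P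

/-- The ideal `∂I` generated by all first partial derivatives of all elements of `I`. -/
def partialIdeal {K : Type*} [Field K] {n : ℕ} (I : Ideal (MvPolynomial (Fin (n + 1)) K)) :
    Ideal (MvPolynomial (Fin (n + 1)) K) :=
  Ideal.span {G | ∃ F ∈ I, ∃ j : Fin (n + 1), G = pderiv j F}

/-- The degree `i` part `I_i = I ∩ S_i` of a (homogeneous) ideal `I` of `S = K[X_0, …, X_n]`. -/
def degreePart {K : Type*} [Field K] {n : ℕ} (I : Ideal (MvPolynomial (Fin (n + 1)) K)) (i : ℕ) :
    Submodule K (MvPolynomial (Fin (n + 1)) K) :=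
  I.restrictScalars K ⊓ homogeneousSubmodule (Fin (n + 1)) K i

/-- The point `(1 : a : b)` of the projective plane over `ℚ`. -/
def affPoint (a b : ℚ) : ℙ ℚ (Fin (2 + 1) → ℚ) :=
  Projectivization.mk ℚ ![1, a, b] (fun h => one_ne_zero (congrFun h 0))

end FatPoints

end

/-! Let `m` be the ideal of the variables, `A = I_X^(k+1) I_Y^l` and `J = I_X^k I_Y^l`. In large
degrees `J` agrees with `m^d J`, so it is enough that `m^d J ⊆ ∂A` for some `d`, i.e. that every
prime `q` containing `∂A : J` contains `m`. Euler's identity gives `A ⊆ ∂A`, so `I_X ⊆ q` and hence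
`I_P ⊆ q` for some `P` in `X`. If `m ⊄ q`, no other `I_R` lies in `q`, and some `h ∉ q` lies in all
of these `I_R`. Up to powers of `h`, only `P` matters: `h^c I_P^(N+1) ⊆ A`, while `J ⊆ I_P^N`. As
`I_P` is generated by linear forms `L_j`, the operator `F ↦ ∑ ∂_j (L_j F)` multiplies products of
`N` of them by a nonzero constant (`sum_pderiv_pivotForm_mul`). So `h^(c+1) J ⊆ ∂A`, which puts a
power of `h` in `q`, a contradiction.

The counterexample compares orders at the origin: neither set is collinear, so both ideals lie in
`m^2`, and `∂(I_X^2 I_Y) ⊆ m^5` misses the square of a common conic. -/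

noncomputable section

namespace FatPoints

open MvPolynomial

attribute [local instance] MvPolynomial.gradedAlgebra

/-! ### Homogeneous ideals and powers of the ideal of the variables -/

section Graded

variable {σ R : Type*} [CommRing R]

theorem isHomogeneous_pow {I : Ideal (MvPolynomial σ R)}
    (hI : I.IsHomogeneous (homogeneousSubmodule σ R)) (k : ℕ) :
    (I ^ k).IsHomogeneous (homogeneousSubmodule σ R) := by
  induction k with
  | zero =>
    rw [pow_zero, Ideal.one_eq_top]
    exact Ideal.IsHomogeneous.top _
  | succ k ih =>
    rw [pow_succ]
    exact ih.mul hI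

theorem isHomogeneous_idealOfVars :
    (idealOfVars σ R).IsHomogeneous (homogeneousSubmodule σ R) := by
  refine Ideal.homogeneous_span _ _ ?_
  rintro _ ⟨i, rfl⟩
  exact ⟨1, isHomogeneous_X R i⟩

/-- Modulo the `d`-th power of the ideal of the variables, every polynomial has degree at most
`d`. -/
theorem exists_mem_pow_idealOfVars_totalDegree_sub_le (d : ℕ) (a : MvPolynomial σ R) :
    ∃ b ∈ idealOfVars σ R ^ d, (a - b).totalDegree ≤ d := by
  refine ⟨a - ∑ i ∈ Finset.range d, homogeneousComponent i a, ?_, ?_⟩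
  · rw [mem_pow_idealOfVars_iff']
    intro x hx
    simp [coeff_sum, coeff_homogeneousComponent, hx]
  · rw [sub_sub_cancel]
    refine totalDegree_finsetSum_le fun i hi => ?_
    exact (homogeneousComponent_isHomogeneous i a).totalDegree_le.trans
      (Finset.mem_range.mp hi).le

/-- The homogeneous elements of sufficiently large degree of a finitely generated homogeneous
ideal `J` lie in `m ^ d * J`, where `m` is the ideal of the variables. -/
theorem exists_forall_isHomogeneous_mem_pow_idealOfVars_mul {J : Ideal (MvPolynomial σ R)}
    (hJ : J.IsHomogeneous (homogeneousSubmodule σ R)) (hfg : J.FG) (d : ℕ) :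
    ∃ i₀ : ℕ, ∀ i ≥ i₀, ∀ F ∈ J, F.IsHomogeneous i → F ∈ idealOfVars σ R ^ d * J := by
  obtain ⟨T, rfl⟩ := hfg
  set D := T.sup totalDegree with hD
  have key : ∀ F ∈ Ideal.span (T : Set (MvPolynomial σ R)),
      ∃ G ∈ idealOfVars σ R ^ d * Ideal.span (T : Set (MvPolynomial σ R)),
        (F - G).totalDegree ≤ d + D := by
    intro F hF
    obtain ⟨c, rfl⟩ := Submodule.mem_span_finset'.mp hF
    choose b hb hdeg using fun t : T =>
      exists_mem_pow_idealOfVars_totalDegree_sub_le d (c t)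
    refine ⟨∑ t : T, b t * t, Ideal.sum_mem _ fun t _ =>
      Ideal.mul_mem_mul (hb t) (Ideal.subset_span t.2), ?_⟩
    simp only [smul_eq_mul, ← Finset.sum_sub_distrib, ← sub_mul]
    refine totalDegree_finsetSum_le fun t _ => ?_
    exact (totalDegree_mul _ _).trans (add_le_add (hdeg t) (Finset.le_sup t.2))
  -- Above degree `d + D` the error `F - G` has no component, so `F` is the degree `i` component of
  -- `G`.
  refine ⟨d + D + 1, fun i hi F hF hFi => ?_⟩
  obtain ⟨G, hG, hGF⟩ := key F hF
  have h0 : homogeneousComponent i (F - G) = 0 := homogeneousComponent_eq_zero _ _ (by omega)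
  rw [map_sub, homogeneousComponent_eq_self hFi, sub_eq_zero] at h0
  rw [h0]
  exact homogeneousComponent_mem_of_mem
    ((isHomogeneous_pow isHomogeneous_idealOfVars d).mul hJ) hG i

theorem pderiv_mem_pow_idealOfVars {N : ℕ} {F : MvPolynomial σ R}
    (hF : F ∈ idealOfVars σ R ^ (N + 1)) (j : σ) : pderiv j F ∈ idealOfVars σ R ^ N := by
  rw [mem_pow_idealOfVars_iff'] at hF ⊢
  intro x hx
  rw [coeff_pderiv, hF, zero_mul]
  simpa using hx

end Graded

/-! ### Euler's identity and ideals of points -/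

variable {K : Type*} [Field K] {n : ℕ}

theorem pderiv_mem_partialIdeal {I : Ideal (MvPolynomial (Fin (n + 1)) K)}
    {F : MvPolynomial (Fin (n + 1)) K} (hF : F ∈ I) (j : Fin (n + 1)) :
    pderiv j F ∈ partialIdeal I :=
  Ideal.subset_span ⟨F, hF, j, rfl⟩

/-- By Euler's identity, a homogeneous ideal without constant terms is contained in the ideal
of its partial derivatives. -/
theorem le_partialIdeal [CharZero K] {I : Ideal (MvPolynomial (Fin (n + 1)) K)}
    (hI : I.IsHomogeneous (homogeneousSubmodule (Fin (n + 1)) K))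
    (hI0 : I ≤ idealOfVars (Fin (n + 1)) K) : I ≤ partialIdeal I := by
  intro F hF
  rw [← sum_homogeneousComponent F]
  refine Ideal.sum_mem _ fun i _ => ?_
  have hFi := homogeneousComponent_mem_of_mem hI hF i
  rcases Nat.eq_zero_or_pos i with rfl | hi
  · have h0 := hI0 hFi
    rw [← pow_one (idealOfVars (Fin (n + 1)) K), homogeneousComponent_zero,
      C_mem_pow_idealOfVars_iff] at h0
    rw [homogeneousComponent_zero, h0.resolve_right one_ne_zero, map_zero]
    exact zero_mem _
  · have he := (homogeneousComponent_isHomogeneous i F).sum_X_mul_pderiv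
    have hi' : (i : K) ≠ 0 := by exact_mod_cast hi.ne'
    have : homogeneousComponent i F = C ((i : K)⁻¹) *
        ∑ j, X j * pderiv j (homogeneousComponent i F) := by
      rw [he, nsmul_eq_mul, ← mul_assoc, ← C_eq_coe_nat, ← C_mul, inv_mul_cancel₀ hi', C_1,
        one_mul]
    rw [this]
    exact Ideal.mul_mem_left _ _ (Ideal.sum_mem _ fun j _ =>
      Ideal.mul_mem_left _ _ (pderiv_mem_partialIdeal hFi j))

/-- The restriction of polynomials to the line through the origin spanned by `v`. -/
def restrictLine (v : Fin (n + 1) → K) : MvPolynomial (Fin (n + 1)) K →ₐ[K] Polynomial K :=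
  aeval fun j => Polynomial.C (v j) * Polynomial.X

/-- Used with `t` a scalar, to change representatives, and with `t` the polynomial variable, to
restrict to a line. -/
theorem aeval_mul_of_isHomogeneous {A : Type*} [CommRing A] [Algebra K A]
    (v : Fin (n + 1) → K) (t : A) {d : ℕ} {F : MvPolynomial (Fin (n + 1)) K}
    (hF : F.IsHomogeneous d) :
    aeval (fun j => algebraMap K A (v j) * t) F = algebraMap K A (eval v F) * t ^ d := by
  rw [aeval_def, eval₂_eq', eval_eq', map_sum, Finset.sum_mul]
  refine Finset.sum_congr rfl fun m hm => ?_
  have hd : ∑ i, m i = d := by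
    rw [← Finsupp.degree_eq_sum, Finsupp.degree_eq_weight_one]
    exact hF (mem_support_iff.mp hm)
  simp only [mul_pow, Finset.prod_mul_distrib, Finset.prod_pow_eq_pow_sum, hd, map_mul, map_prod,
    map_pow, mul_assoc]

/-- The linear forms `v_p X_i - v_i X_p`, which vanish at `v`. -/
def pivotForm (v : Fin (n + 1) → K) (p i : Fin (n + 1)) : MvPolynomial (Fin (n + 1)) K :=
  C (v p) * X i - C (v i) * X p

theorem isHomogeneous_pivotForm (v : Fin (n + 1) → K) (p i : Fin (n + 1)) :
    (pivotForm v p i).IsHomogeneous 1 :=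
  (isHomogeneous_C_mul_X _ _).sub (isHomogeneous_C_mul_X _ _)

theorem eval_pivotForm (v w : Fin (n + 1) → K) (p i : Fin (n + 1)) :
    eval w (pivotForm v p i) = v p * w i - v i * w p := by
  simp [pivotForm]

/-- If `v` represents `P`, the ideal of `P` consists of polynomials vanishing on the line
spanned by `v`. -/
theorem restrictLine_eq_zero_of_mem_pointIdeal {v : Fin (n + 1) → K} (hv : v ≠ 0)
    {F : MvPolynomial (Fin (n + 1)) K}
    (hF : F ∈ pointIdeal (Projectivization.mk K v hv)) : restrictLine v F = 0 := by
  suffices pointIdeal (Projectivization.mk K v hv) ≤ RingHom.ker (restrictLine v) from this hF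
  refine Ideal.span_le.mpr ?_
  rintro G ⟨⟨d, hd⟩, h0⟩
  obtain ⟨a, ha⟩ := Projectivization.exists_smul_eq_mk_rep K v hv
  have h1 : eval ((a : K) • v) G = (a : K) ^ d * eval v G := by
    have := aeval_mul_of_isHomogeneous v (a : K) hd
    rw [mul_comm]
    simpa [aeval_eq_eval, Pi.smul_def, mul_comm] using this
  rw [← ha] at h0
  have h2 : eval v G = 0 := by
    have : (a : K) ^ d * eval v G = 0 := h1.symm.trans h0
    exact (mul_eq_zero.mp this).resolve_left (pow_ne_zero _ a.ne_zero)
  refine (aeval_mul_of_isHomogeneous v Polynomial.X hd).trans ?_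
  rw [h2, map_zero, zero_mul]

theorem mem_span_pivotForm {v : Fin (n + 1) → K} {p : Fin (n + 1)} (hp : v p ≠ 0)
    {F : MvPolynomial (Fin (n + 1)) K} (hF : restrictLine v F = 0) :
    F ∈ Ideal.span (Set.range (pivotForm v p)) := by
  set I := Ideal.span (Set.range (pivotForm v p))
  let t : MvPolynomial (Fin (n + 1)) K := C (v p)⁻¹ * X p
  -- Modulo the pivot forms `X i` equals `v i * t`, so `F` is determined there by its restriction to
  -- the line.
  have hcomp : (Ideal.Quotient.mkₐ K I).comp ((Polynomial.aeval t).comp (restrictLine v)) =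
      Ideal.Quotient.mkₐ K I := by
    ext i
    simp only [AlgHom.comp_apply, restrictLine, aeval_X, map_mul, Polynomial.aeval_C,
      Polynomial.aeval_X, Ideal.Quotient.mkₐ_eq_mk]
    rw [← map_mul, Ideal.Quotient.eq]
    have : algebraMap K (MvPolynomial (Fin (n + 1)) K) (v i) * t - X i =
        - C (v p)⁻¹ * pivotForm v p i := by
      have h : C (v p)⁻¹ * C (v p) = (1 : MvPolynomial (Fin (n + 1)) K) := by
        rw [← C_mul, inv_mul_cancel₀ hp, C_1]
      simp only [pivotForm, t, algebraMap_eq]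
      linear_combination X i * h
    rw [this]
    exact Ideal.mul_mem_left _ _ (Ideal.subset_span ⟨i, rfl⟩)
  have := DFunLike.congr_fun hcomp F
  simp only [AlgHom.comp_apply, hF, map_zero] at this
  exact Ideal.Quotient.eq_zero_iff_mem.mp this.symm

/-- Linear generators make powers of `I_P` spanned by products of linear forms, where Euler-type
identities apply. -/
theorem pointIdeal_eq_span (P : ℙ K (Fin (n + 1) → K)) {p : Fin (n + 1)} (hp : P.rep p ≠ 0) :
    pointIdeal P = Ideal.span (Set.range (pivotForm P.rep p)) := by
  apply le_antisymm
  · intro F hF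
    refine mem_span_pivotForm hp (restrictLine_eq_zero_of_mem_pointIdeal P.rep_nonzero ?_)
    rwa [Projectivization.mk_rep]
  · refine Ideal.span_mono ?_
    rintro _ ⟨i, rfl⟩
    refine ⟨⟨1, isHomogeneous_pivotForm _ _ _⟩, ?_⟩
    rw [eval_pivotForm]
    ring

theorem isHomogeneous_vanishingIdeal (X : Set (ℙ K (Fin (n + 1) → K))) :
    (vanishingIdeal X).IsHomogeneous (homogeneousSubmodule (Fin (n + 1)) K) :=
  Ideal.IsHomogeneous.iInf₂ fun _ _ => Ideal.homogeneous_span _ _ fun _ hF => hF.1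

theorem pointIdeal_le_idealOfVars (P : ℙ K (Fin (n + 1) → K)) :
    pointIdeal P ≤ idealOfVars (Fin (n + 1)) K := by
  obtain ⟨p, hp⟩ := Function.ne_iff.mp P.rep_nonzero
  rw [pointIdeal_eq_span P hp, Ideal.span_le]
  rintro _ ⟨i, rfl⟩
  exact Ideal.sub_mem _ (Ideal.mul_mem_left _ _ (Ideal.subset_span ⟨i, rfl⟩))
    (Ideal.mul_mem_left _ _ (Ideal.subset_span ⟨p, rfl⟩))

/-- A point different from `Q` is not a zero of all linear forms vanishing at `Q`. -/
theorem exists_pivotForm_ne_zero {P Q : ℙ K (Fin (n + 1) → K)} (hPQ : P ≠ Q)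
    {q : Fin (n + 1)} (hq : Q.rep q ≠ 0) : ∃ i, eval P.rep (pivotForm Q.rep q i) ≠ 0 := by
  by_contra! h
  apply hPQ
  rw [← P.mk_rep, ← Q.mk_rep, Projectivization.mk_eq_mk_iff']
  refine ⟨P.rep q / Q.rep q, ?_⟩
  ext i
  have := h i
  rw [eval_pivotForm] at this
  simp only [Pi.smul_apply, smul_eq_mul]
  field_simp
  linear_combination -this

theorem dim_ne_zero_of_ne {P Q : ℙ K (Fin (n + 1) → K)} (hPQ : P ≠ Q) : n ≠ 0 := by
  rintro rfl
  obtain ⟨q, hq⟩ := Function.ne_iff.mp Q.rep_nonzero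
  obtain ⟨i, hi⟩ := exists_pivotForm_ne_zero hPQ hq
  rw [eval_pivotForm, Fin.fin_one_eq_zero i, Fin.fin_one_eq_zero q] at hi
  simp at hi

/-- An ideal containing the ideals of two distinct points contains all variables. -/
theorem idealOfVars_le_of_pointIdeal_le {P Q : ℙ K (Fin (n + 1) → K)} (hPQ : P ≠ Q)
    {q : Ideal (MvPolynomial (Fin (n + 1)) K)} (hP : pointIdeal P ≤ q) (hQ : pointIdeal Q ≤ q) :
    idealOfVars (Fin (n + 1)) K ≤ q := by
  obtain ⟨a, ha⟩ := Function.ne_iff.mp P.rep_nonzero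
  obtain ⟨b, hb⟩ := Function.ne_iff.mp Q.rep_nonzero
  obtain ⟨i, hi⟩ := exists_pivotForm_ne_zero hPQ hb
  rw [eval_pivotForm] at hi
  set v := P.rep
  set w := Q.rep
  have hPm (j) : pivotForm v a j ∈ q := hP (by
    rw [pointIdeal_eq_span P ha]; exact Ideal.subset_span ⟨j, rfl⟩)
  have hQm : pivotForm w b i ∈ q := hQ (by
    rw [pointIdeal_eq_span Q hb]; exact Ideal.subset_span ⟨i, rfl⟩)
  have hunit {c : K} (hc : c ≠ 0) {F : MvPolynomial (Fin (n + 1)) K} (h : C c * F ∈ q) :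
      F ∈ q := by
    have := q.mul_mem_left (C c⁻¹) h
    rwa [← mul_assoc, ← C_mul, inv_mul_cancel₀ hc, C_1, one_mul] at this
  have hXa : (X a : MvPolynomial (Fin (n + 1)) K) ∈ q := by
    refine hunit hi ?_
    -- This combination eliminates `X i` and `X b`, leaving a nonzero multiple of `X a`.
    have h := Ideal.sub_mem q (q.mul_mem_left (C (v a)) hQm)
      (Ideal.sub_mem q (q.mul_mem_left (C (w b)) (hPm i)) (q.mul_mem_left (C (w i)) (hPm b)))
    convert h using 1
    simp only [pivotForm, C_sub, C_mul]
    ring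
  refine Ideal.span_le.mpr ?_
  rintro _ ⟨j, rfl⟩
  refine hunit ha ?_
  have h := Ideal.add_mem q (hPm j) (q.mul_mem_left (C (v j)) hXa)
  convert h using 1
  simp only [pivotForm]
  ring

/-! ### Differential identities for the pivot forms -/

theorem sum_pivotForm_mul_pderiv_pivotForm (v : Fin (n + 1) → K) (p i : Fin (n + 1)) :
    ∑ j, pivotForm v p j * pderiv j (pivotForm v p i) = C (v p) * pivotForm v p i := by
  classical
  have h0 : pivotForm v p p = 0 := by simp [pivotForm]
  have (j : Fin (n + 1)) : pivotForm v p j * pderiv j (pivotForm v p i) =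
      (if i = j then C (v p) * pivotForm v p j else 0) -
        if p = j then C (v i) * pivotForm v p j else 0 := by
    conv_lhs => rw [pivotForm.eq_def v p i]
    simp only [map_sub, pderiv_C_mul, pderiv_X, Pi.single_apply]
    split_ifs <;> ring
  simp [this, h0]

open scoped Pointwise in
/-- Euler's identity for products of linear forms vanishing at `v`. -/
theorem sum_pivotForm_mul_pderiv_of_mem_pow (v : Fin (n + 1) → K) (p : Fin (n + 1)) {N : ℕ}
    {F : MvPolynomial (Fin (n + 1)) K} (hF : F ∈ Set.range (pivotForm v p) ^ N) :
    ∑ j, pivotForm v p j * pderiv j F = C (N * v p) * F := by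
  induction N generalizing F with
  | zero =>
    rw [pow_zero, Set.mem_one] at hF
    simp [hF]
  | succ N ih =>
    rw [pow_succ] at hF
    obtain ⟨G, hG, _, ⟨i, rfl⟩, rfl⟩ := Set.mem_mul.mp hF
    have (j : Fin (n + 1)) : pivotForm v p j * pderiv j (G * pivotForm v p i) =
        pivotForm v p j * pderiv j G * pivotForm v p i +
          G * (pivotForm v p j * pderiv j (pivotForm v p i)) := by
      rw [pderiv_mul]
      ring
    simp only [this, Finset.sum_add_distrib, ← Finset.sum_mul, ← Finset.mul_sum, ih hG,
      sum_pivotForm_mul_pderiv_pivotForm]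
    push_cast
    simp only [C_mul, C_add, C_1]
    ring

open scoped Pointwise in
/-- Products of `N` linear forms vanishing at `v` are recovered from the partial derivatives of
products of `N + 1` such forms. -/
theorem sum_pderiv_pivotForm_mul (v : Fin (n + 1) → K) (p : Fin (n + 1)) {N : ℕ}
    {F : MvPolynomial (Fin (n + 1)) K} (hF : F ∈ Set.range (pivotForm v p) ^ N) :
    ∑ j, pderiv j (pivotForm v p j * F) = C ((n + N : ℕ) * v p) * F := by
  classical
  -- The factor is `n`, not `n + 1`, because the form with `j = p` is zero.
  have hdiv : ∑ j, pderiv j (pivotForm v p j) = (n : MvPolynomial (Fin (n + 1)) K) * C (v p) := by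
    have (j : Fin (n + 1)) : pderiv j (pivotForm v p j) =
        C (v p) - if p = j then C (v p) else 0 := by
      simp only [pivotForm, map_sub, pderiv_C_mul, pderiv_X, Pi.single_apply]
      split_ifs with h <;> simp_all
    simp [this, add_mul]
  have heuler := sum_pivotForm_mul_pderiv_of_mem_pow v p hF
  simp only [pderiv_mul, Finset.sum_add_distrib, ← Finset.sum_mul, hdiv, heuler]
  simp
  ring

theorem vanishingIdeal_le_pointIdeal {X : Set (ℙ K (Fin (n + 1) → K))}
    {P : ℙ K (Fin (n + 1) → K)} (hP : P ∈ X) : vanishingIdeal X ≤ pointIdeal P :=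
  iInf₂_le P hP

/-! ### The containment in large degrees -/

section CharZero

variable [CharZero K]

/-- If `h` carries `I_P ^ (N + 1)` into `A`, where `A` is contained in `∂A`, then a further
multiple by `h` carries `I_P ^ N` into `∂A`. -/
theorem mul_mem_partialIdeal (hn : n ≠ 0) {A : Ideal (MvPolynomial (Fin (n + 1)) K)}
    (hA : A ≤ partialIdeal A) (P : ℙ K (Fin (n + 1) → K)) {N : ℕ}
    {h : MvPolynomial (Fin (n + 1)) K} {c : ℕ}
    (hh : ∀ G ∈ pointIdeal P ^ (N + 1), h ^ c * G ∈ A)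
    {F : MvPolynomial (Fin (n + 1)) K} (hF : F ∈ pointIdeal P ^ N) :
    h ^ (c + 1) * F ∈ partialIdeal A := by
  obtain ⟨p, hp⟩ := Function.ne_iff.mp P.rep_nonzero
  have hder : ∀ G ∈ pointIdeal P ^ (N + 1), ∀ j, h ^ (c + 1) * pderiv j G ∈ partialIdeal A := by
    intro G hG j
    have h1 : h ^ (c + 1) * G ∈ A := by
      rw [pow_succ', mul_assoc]
      exact A.mul_mem_left _ (hh G hG)
    have h2 := (partialIdeal A).mul_mem_left ((c + 1 : ℕ) * pderiv j h) (hA (hh G hG))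
    -- Leibniz: `h^(c+1) ∂G = ∂(h^(c+1) G) - (c+1) ∂h · h^c G`.
    convert Ideal.sub_mem _ (pderiv_mem_partialIdeal h1 j) h2 using 1
    rw [pderiv_mul, pderiv_pow, Nat.add_sub_cancel]
    ring
  rw [pointIdeal_eq_span P hp] at hF hder
  suffices Ideal.span (Set.range (pivotForm P.rep p)) ^ N ≤
      Submodule.comap (LinearMap.mulLeft (MvPolynomial (Fin (n + 1)) K) (h ^ (c + 1)))
        (partialIdeal A) from
    this hF
  rw [Ideal.span, Submodule.span_pow]
  refine Submodule.span_le.mpr fun F hF => ?_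
  -- For `N = 0` this needs `n ≠ 0`, which two distinct points guarantee.
  have hc : ((n + N : ℕ) * P.rep p : K) ≠ 0 :=
    mul_ne_zero (by exact_mod_cast (by omega : n + N ≠ 0)) hp
  have hFmem : F ∈ Ideal.span (Set.range (pivotForm P.rep p)) ^ N := by
    rw [Ideal.span, Submodule.span_pow]
    exact Submodule.subset_span hF
  have hsum : h ^ (c + 1) * ∑ j, pderiv j (pivotForm P.rep p j * F) ∈ partialIdeal A := by
    rw [Finset.mul_sum]
    refine Ideal.sum_mem _ fun j _ => hder _ ?_ j
    rw [pow_succ']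
    exact Ideal.mul_mem_mul (Ideal.subset_span ⟨j, rfl⟩) hFmem
  rw [sum_pderiv_pivotForm_mul _ _ hF] at hsum
  have := (partialIdeal A).mul_mem_left (C ((n + N : ℕ) * P.rep p : K)⁻¹) hsum
  rwa [mul_left_comm, ← mul_assoc (C _) (C _), ← C_mul, inv_mul_cancel₀ hc, C_1, one_mul] at this

/-- A polynomial `h` vanishing at all points of `X` other than `P` has a power that multiplies
`I_X ^ k * I_Y ^ l` into `∂(I_X ^ (k + 1) * I_Y ^ l)`. -/
theorem pow_mul_mem_partialIdeal (hn : n ≠ 0) {X Y : Set (ℙ K (Fin (n + 1) → K))} (hYX : Y ⊆ X)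
    (k l : ℕ)
    (hA : vanishingIdeal X ^ (k + 1) * vanishingIdeal Y ^ l ≤
      partialIdeal (vanishingIdeal X ^ (k + 1) * vanishingIdeal Y ^ l))
    {P : ℙ K (Fin (n + 1) → K)} (hP : P ∈ X) {h : MvPolynomial (Fin (n + 1)) K}
    (hh : ∀ Q ∈ X, Q ≠ P → h ∈ pointIdeal Q) {F : MvPolynomial (Fin (n + 1)) K}
    (hF : F ∈ vanishingIdeal X ^ k * vanishingIdeal Y ^ l) :
    h ^ (k + 1 + l + 1) * F ∈
      partialIdeal (vanishingIdeal X ^ (k + 1) * vanishingIdeal Y ^ l) := by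
  have hmul {Z : Set (ℙ K (Fin (n + 1) → K))} (hZ : Z ⊆ X) :
      Ideal.span {h} * pointIdeal P ≤ vanishingIdeal Z := by
    refine le_iInf₂ fun Q hQ => ?_
    by_cases hQP : Q = P
    · exact hQP ▸ Ideal.mul_le_right
    · exact Ideal.mul_le_left.trans
        ((Ideal.span_singleton_le_iff_mem _).mpr (hh Q (hZ hQ) hQP))
  have hpow : h ^ (k + 1 + l) ∈ Ideal.span {h} ^ (k + 1 + l) :=
    Ideal.pow_mem_pow (Ideal.mem_span_singleton_self h) _
  -- The order at `P` is `N = k + l` if `P ∈ Y`; otherwise `h ∈ I_Y` absorbs the factor `I_Y ^ l`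
  -- and `N = k`.
  by_cases hPY : P ∈ Y
  · refine mul_mem_partialIdeal hn hA P (N := k + l) (fun G hG => ?_) ?_
    · have hle : Ideal.span {h} ^ (k + 1 + l) * pointIdeal P ^ (k + l + 1) ≤
          vanishingIdeal X ^ (k + 1) * vanishingIdeal Y ^ l := by
        rw [show k + l + 1 = k + 1 + l by ring, ← mul_pow, pow_add]
        exact Ideal.mul_mono (Ideal.pow_right_mono (hmul subset_rfl) _)
          (Ideal.pow_right_mono (hmul hYX) _)
      exact hle (Ideal.mul_mem_mul hpow hG)
    · rw [pow_add]
      exact Ideal.mul_mono (Ideal.pow_right_mono (vanishingIdeal_le_pointIdeal hP) _)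
        (Ideal.pow_right_mono (vanishingIdeal_le_pointIdeal hPY) _) hF
  · refine mul_mem_partialIdeal hn hA P (N := k) (fun G hG => ?_) ?_
    · have hhY : Ideal.span {h} ≤ vanishingIdeal Y := le_iInf₂ fun Q hQ =>
        (Ideal.span_singleton_le_iff_mem _).mpr (hh Q (hYX hQ) fun e => hPY (e ▸ hQ))
      have hle : Ideal.span {h} ^ (k + 1 + l) * pointIdeal P ^ (k + 1) ≤
          vanishingIdeal X ^ (k + 1) * vanishingIdeal Y ^ l := by
        rw [pow_add, mul_right_comm, ← mul_pow]
        exact Ideal.mul_mono (Ideal.pow_right_mono (hmul subset_rfl) _)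
          (Ideal.pow_right_mono hhY _)
      exact hle (Ideal.mul_mem_mul hpow hG)
    · exact Ideal.pow_right_mono (vanishingIdeal_le_pointIdeal hP) _ (Ideal.mul_le_left hF)

/-- Some power of the ideal of the variables multiplies `I_X ^ k * I_Y ^ l` into
`∂(I_X ^ (k + 1) * I_Y ^ l)`. -/
theorem exists_pow_idealOfVars_mul_le {X Y : Set (ℙ K (Fin (n + 1) → K))} (hX : X.Finite)
    (hX2 : 2 ≤ X.ncard) (hYX : Y ⊆ X) (k l : ℕ) :
    ∃ d, idealOfVars (Fin (n + 1)) K ^ d * (vanishingIdeal X ^ k * vanishingIdeal Y ^ l) ≤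
      partialIdeal (vanishingIdeal X ^ (k + 1) * vanishingIdeal Y ^ l) := by
  obtain ⟨P₀, hP₀, Q₀, hQ₀, hPQ₀⟩ := (Set.one_lt_ncard hX).mp hX2
  have hn : n ≠ 0 := dim_ne_zero_of_ne hPQ₀
  have hA : vanishingIdeal X ^ (k + 1) * vanishingIdeal Y ^ l ≤
      partialIdeal (vanishingIdeal X ^ (k + 1) * vanishingIdeal Y ^ l) := by
    refine le_partialIdeal ((isHomogeneous_pow (isHomogeneous_vanishingIdeal X) _).mul
      (isHomogeneous_pow (isHomogeneous_vanishingIdeal Y) _)) ?_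
    exact (Ideal.mul_le_left.trans (Ideal.pow_le_self k.succ_ne_zero)).trans
      ((vanishingIdeal_le_pointIdeal hP₀).trans (pointIdeal_le_idealOfVars P₀))
  set J := vanishingIdeal X ^ k * vanishingIdeal Y ^ l with hJ
  set B := partialIdeal (vanishingIdeal X ^ (k + 1) * vanishingIdeal Y ^ l) with hB
  let Q : Ideal (MvPolynomial (Fin (n + 1)) K) := B.colon J
  have hXQ : vanishingIdeal X ≤ Q := by
    intro f hf
    refine Submodule.mem_colon.mpr fun F hF => hA ?_
    rw [pow_succ', mul_assoc]
    exact Ideal.mul_mem_mul hf hF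
  have hrad : idealOfVars (Fin (n + 1)) K ≤ Q.radical := by
    rw [Ideal.radical_eq_sInf]
    refine le_sInf fun q ⟨hq, hqp⟩ => ?_
    by_contra hm
    have hprime : ∃ P ∈ X, pointIdeal P ≤ q := by
      have : hX.toFinset.inf pointIdeal ≤ q := by
        refine le_trans ?_ (hXQ.trans hq)
        refine le_iInf₂ fun P hP => Finset.inf_le (hX.mem_toFinset.mpr hP)
      obtain ⟨P, hP, hPq⟩ := (Ideal.IsPrime.inf_le' hqp).mp this
      exact ⟨P, hX.mem_toFinset.mp hP, hPq⟩
    obtain ⟨P, hP, hPq⟩ := hprime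
    have hout (R : ℙ K (Fin (n + 1) → K)) : ∃ g, R ≠ P → g ∈ pointIdeal R ∧ g ∉ q := by
      by_cases hR : R = P
      · exact ⟨0, fun h => absurd hR h⟩
      · obtain ⟨g, hg, hgq⟩ := SetLike.not_le_iff_exists.mp fun hle =>
          hm (idealOfVars_le_of_pointIdeal_le (Ne.symm hR) hPq hle)
        exact ⟨g, fun _ => ⟨hg, hgq⟩⟩
    choose g hg using hout
    classical
    set h := ∏ R ∈ hX.toFinset.erase P, g R with hh
    have hhR : ∀ R ∈ X, R ≠ P → h ∈ pointIdeal R := fun R hR hRP =>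
      Ideal.mem_of_dvd _ (Finset.dvd_prod_of_mem g
        (Finset.mem_erase.mpr ⟨hRP, hX.mem_toFinset.mpr hR⟩)) (hg R hRP).1
    have hhq : h ∉ q := by
      rw [hh, Ideal.IsPrime.prod_mem_iff]
      rintro ⟨R, hR, hRq⟩
      exact (hg R (Finset.ne_of_mem_erase hR)).2 hRq
    refine hhq (hqp.mem_of_pow_mem (k + 1 + l + 1) (hq ?_))
    exact Submodule.mem_colon.mpr fun F hF => pow_mul_mem_partialIdeal hn hYX k l hA hP hhR hF
  obtain ⟨d, hd⟩ := Ideal.exists_pow_le_of_le_radical_of_fg hrad (idealOfVars_fg _ _)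
  exact ⟨d, Ideal.mul_le.mpr fun f hf F hF => Submodule.mem_colon.mp (hd hf) F hF⟩

theorem exists_degreePart_le {X Y : Set (ℙ K (Fin (n + 1) → K))} (hX : X.Finite)
    (hX2 : 2 ≤ X.ncard) (hYX : Y ⊆ X) (k l : ℕ) : ∃ i₀ : ℕ, ∀ i ≥ i₀,
      degreePart (vanishingIdeal X ^ k * vanishingIdeal Y ^ l) i ≤
        degreePart (partialIdeal (vanishingIdeal X ^ (k + 1) * vanishingIdeal Y ^ l)) i := by
  obtain ⟨d, hd⟩ := exists_pow_idealOfVars_mul_le hX hX2 hYX k l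
  obtain ⟨i₀, hi₀⟩ := exists_forall_isHomogeneous_mem_pow_idealOfVars_mul
    ((isHomogeneous_pow (isHomogeneous_vanishingIdeal X) k).mul
      (isHomogeneous_pow (isHomogeneous_vanishingIdeal Y) l)) (IsNoetherian.noetherian _) d
  exact ⟨i₀, fun i hi F ⟨hFJ, hFi⟩ => ⟨hd (hi₀ i hi F hFJ hFi), hFi⟩⟩

end CharZero

/-! ### The counterexample in the plane -/

/-- The linear part of a polynomial in the ideal of the point represented by `v` vanishes at
`v`. -/
theorem sum_coeff_single_mul_eq_zero {v : Fin (n + 1) → K} (hv : v ≠ 0)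
    {F : MvPolynomial (Fin (n + 1)) K} (hF : F ∈ pointIdeal (Projectivization.mk K v hv)) :
    ∑ j, coeff (Finsupp.single j 1) F * v j = 0 := by
  have hF1 := homogeneousComponent_isHomogeneous 1 F
  have hmem := homogeneousComponent_mem_of_mem
    (Ideal.homogeneous_span _ _ fun _ hG => hG.1) hF 1
  have hline := restrictLine_eq_zero_of_mem_pointIdeal hv hmem
  rw [restrictLine, ← Polynomial.algebraMap_eq, aeval_mul_of_isHomogeneous v Polynomial.X hF1,
    pow_one, Polynomial.algebraMap_eq, mul_eq_zero, Polynomial.C_eq_zero] at hline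
  have heval : eval v (homogeneousComponent 1 F) = 0 := hline.resolve_right Polynomial.X_ne_zero
  have hpderiv (j : Fin (n + 1)) : pderiv j (homogeneousComponent 1 F) =
      C (coeff (Finsupp.single j 1) F) := by
    rw [← homogeneousComponent_eq_self (hF1.pderiv (i := j)), Nat.sub_self,
      homogeneousComponent_zero, coeff_pderiv]
    simp [coeff_homogeneousComponent]
  have heuler := congrArg (eval v) hF1.sum_X_mul_pderiv
  simpa [hpderiv, heval, mul_comm] using heuler

/-- No polynomial vanishing at `(1 : 0 : 0)`, `(1 : 0 : 1)` and `(1 : a : 0)`, where `a ≠ 0`, has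
terms of degree less than two. -/
theorem vanishingIdeal_le_sq_idealOfVars {a : ℚ} (ha : a ≠ 0)
    {X : Set (ℙ ℚ (Fin (2 + 1) → ℚ))} (h00 : affPoint 0 0 ∈ X) (h01 : affPoint 0 1 ∈ X)
    (ha0 : affPoint a 0 ∈ X) : vanishingIdeal X ≤ idealOfVars (Fin (2 + 1)) ℚ ^ 2 := by
  intro F hF
  have h1 := sum_coeff_single_mul_eq_zero _ (vanishingIdeal_le_pointIdeal h00 hF)
  have h2 := sum_coeff_single_mul_eq_zero _ (vanishingIdeal_le_pointIdeal h01 hF)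
  have h3 := sum_coeff_single_mul_eq_zero _ (vanishingIdeal_le_pointIdeal ha0 hF)
  have h0 : F ∈ idealOfVars (Fin (2 + 1)) ℚ ^ 1 := by
    rw [pow_one]
    exact pointIdeal_le_idealOfVars _ (vanishingIdeal_le_pointIdeal h00 hF)
  rw [mem_pow_idealOfVars_iff'] at h0 ⊢
  simp [Fin.sum_univ_three] at h1 h2 h3
  rw [h1] at h2 h3
  simp [ha] at h2 h3
  intro x hx
  rcases Nat.lt_or_ge x.degree 1 with hx0 | hx1
  · exact h0 x hx0
  · obtain ⟨j, rfl⟩ : ∃ j, x = Finsupp.single j 1 := by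
      obtain ⟨j, hj⟩ : ∃ j, x j ≠ 0 := by
        by_contra! h
        simp [show x = 0 from Finsupp.ext h] at hx1
      obtain ⟨c, rfl⟩ := le_iff_exists_add.mp
        (Finsupp.single_le_iff.mpr (Nat.one_le_iff_ne_zero.mpr hj))
      rw [map_add, Finsupp.degree_single] at hx
      have hc : c = 0 := (Finsupp.degree_eq_zero_iff c).mp (by omega)
      exact ⟨j, by rw [hc, add_zero]⟩
    fin_cases j
    · exact h1
    · exact h3
    · exact h2

/-- The ideal of `(1 : a : b)` contains `X_2 (X_2 - X_0)` when `b` is `0` or `1`. -/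
theorem conic_mem_pointIdeal (a b : ℚ) (hb : b * (b - 1) = 0) :
    (X 2 * (X 2 - X 0) : MvPolynomial (Fin (2 + 1)) ℚ) ∈ pointIdeal (affPoint a b) := by
  refine Ideal.subset_span ⟨⟨2, ?_⟩, ?_⟩
  · exact (isHomogeneous_X ℚ 2).mul ((isHomogeneous_X ℚ 2).sub (isHomogeneous_X ℚ 0))
  · obtain ⟨c, hc⟩ := Projectivization.exists_smul_eq_mk_rep ℚ ![1, a, b]
      (fun h => one_ne_zero (congrFun h 0))
    rw [affPoint, ← hc]
    have : (c : ℚ) * b * (c * b - c) = 0 := by linear_combination (c : ℚ) ^ 2 * hb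
    simpa [Units.smul_def] using this

/-- All elements of `∂(I_X ^ 2 * I_Y)` have order at least five, but `I_X * I_Y` contains a nonzero
form of degree four. -/
theorem not_degreePart_le {a : ℚ} (ha : a ≠ 0) {X Y : Set (ℙ ℚ (Fin (2 + 1) → ℚ))}
    (hX : X = {affPoint 0 0, affPoint 0 1, affPoint 1 0, affPoint 1 1})
    (hY : Y = {affPoint 0 0, affPoint 0 1, affPoint a 0, affPoint a 1}) :
    ¬ degreePart (vanishingIdeal X * vanishingIdeal Y) 4 ≤
      degreePart (partialIdeal (vanishingIdeal X ^ 2 * vanishingIdeal Y)) 4 := by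
  intro hle
  set Q : MvPolynomial (Fin (2 + 1)) ℚ := MvPolynomial.X 2 * (MvPolynomial.X 2 - MvPolynomial.X 0)
  have hQ : Q.IsHomogeneous 2 :=
    (isHomogeneous_X ℚ 2).mul ((isHomogeneous_X ℚ 2).sub (isHomogeneous_X ℚ 0))
  have hQX : Q ∈ vanishingIdeal X := by
    simp only [vanishingIdeal, Submodule.mem_iInf, hX]
    rintro P (rfl | rfl | rfl | rfl) <;> exact conic_mem_pointIdeal _ _ (by norm_num)
  have hQY : Q ∈ vanishingIdeal Y := by
    simp only [vanishingIdeal, Submodule.mem_iInf, hY]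
    rintro P (rfl | rfl | rfl | rfl) <;> exact conic_mem_pointIdeal _ _ (by norm_num)
  have hXm : vanishingIdeal X ≤ idealOfVars (Fin (2 + 1)) ℚ ^ 2 :=
    vanishingIdeal_le_sq_idealOfVars one_ne_zero (by simp [hX]) (by simp [hX]) (by simp [hX])
  have hYm : vanishingIdeal Y ≤ idealOfVars (Fin (2 + 1)) ℚ ^ 2 :=
    vanishingIdeal_le_sq_idealOfVars ha (by simp [hY]) (by simp [hY]) (by simp [hY])
  have hpart : partialIdeal (vanishingIdeal X ^ 2 * vanishingIdeal Y) ≤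
      idealOfVars (Fin (2 + 1)) ℚ ^ 5 := by
    refine Ideal.span_le.mpr ?_
    rintro _ ⟨F, hF, j, rfl⟩
    refine pderiv_mem_pow_idealOfVars ?_ j
    have := Ideal.mul_mono (Ideal.pow_right_mono hXm 2) hYm hF
    -- The order is at least `2 * 2 + 2 = 5 + 1`, and differentiation costs one.
    rwa [← pow_mul, ← pow_add] at this
  have hmem : Q * Q ∈ idealOfVars (Fin (2 + 1)) ℚ ^ 5 :=
    hpart (hle ⟨Ideal.mul_mem_mul hQX hQY, hQ.mul hQ⟩).1
  have hzero : Q * Q = 0 := by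
    ext x
    rw [coeff_zero]
    by_contra hx
    have hdeg := (mem_pow_idealOfVars_iff _ _).mp hmem x (mem_support_iff.mpr hx)
    have h4 : x.degree = 4 := by
      rw [Finsupp.degree_eq_weight_one]
      exact (hQ.mul hQ) hx
    omega
  -- `Q` takes the value `1` at `(0, 0, 1)`.
  have := congrArg (eval ![0, 0, 1]) hzero
  simp [Q] at this

end FatPoints

end

open FatPoints in
theorem lemma3p4 :
    (∀ (K : Type*) [Field K] [CharZero K] (n : ℕ) (X Y : Set (ℙ K (Fin (n + 1) → K))),
      X.Finite → 2 ≤ X.ncard → Y.Nonempty → Y ⊆ X →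
      ∀ k l : ℕ, ∃ i₀ : ℕ, ∀ i ≥ i₀,
        degreePart (vanishingIdeal X ^ k * vanishingIdeal Y ^ l) i ≤
          degreePart (partialIdeal (vanishingIdeal X ^ (k + 1) * vanishingIdeal Y ^ l)) i) ∧
    (∀ X Y : Set (ℙ ℚ (Fin (2 + 1) → ℚ)),
      X = {affPoint 0 0, affPoint 0 1, affPoint 1 0, affPoint 1 1} →
      Y = {affPoint 0 0, affPoint 0 1, affPoint 2 0, affPoint 2 1} →
      ¬ degreePart (vanishingIdeal X * vanishingIdeal Y) 4 ≤
          degreePart (partialIdeal (vanishingIdeal X ^ 2 * vanishingIdeal Y)) 4) := by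
  exact ⟨fun K _ _ n X Y hX hX2 _ hYX k l => exists_degreePart_le hX hX2 hYX k l,
    fun X Y hX hY => not_degreePart_le two_ne_zero hX hY⟩
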